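/- Let $J\ge 1$ and fix discriminations $\alpha=(\alpha_1,\dots,\alpha_J)$ with all $\alpha_s>0$. In the generalized partial credit model an item with threshold vector $\tau\in\mathbb{R}^J$, answered by a person of ability $\theta\in\mathbb{R}$, yields category $j\in\{0,\dots,J\}$ with probability $$\pi_j(\theta,\tau,\alpha)=\frac{\exp\big(\sum_{s=1}^{j}\alpha_s(\theta-\tau_s)\big)}{\sum_{k=0}^{J}\exp\big(\sum_{s=1}^{k}\alpha_s(\theta-\tau_s)\big)},$$ and $M(\theta,\tau,\alpha)$ denotes the Fisher information about $\theta$ of one item, i.e. the variance of $\frac{d}{d\theta}\log\pi_Y(\theta,\tau,\alpha)$ when $Y$ has law $(\pi_0,\dots,\pi_J)$. An approximate design $\xi$ is a finitely supported probability distribution on threshold vectors in $\mathbb{R}^J$, with information $M(\theta,\xi)=\sum_\tau \xi(\tau)M(\theta,\tau,\alpha)$. Let $\Pi$ be a probability distribution on $\mathbb{R}$ that is symmetric around some $\theta_0\in\mathbb{R}$. The limiting threshold $\tau^*$ is the formal limit, as $c\to\infty$, of the vectors $\theta_0+(\alpha_Jc,0,\dots,0,-\alpha_1c)$ (for $J=1$: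 of the constant $\theta_0$), where $\theta_0$ is added to every coordinate; $\pi_j(\theta,\tau^*,\alpha)$ and $M(\theta,\tau^*,\alpha)$ are the corresponding limits of $\pi_j$ and $M$. For a function $M$ of $\theta$ put $\psi_0=\int\log M(\theta)\,d\Pi(\theta)$ and $\psi_{-1}=-\int M(\theta)^{-1}\,d\Pi(\theta)$. Call $\tau^*$ Bayes optimal under $\psi_v$ ($v\in\{0,-1\}$) if the value of $\psi_v$ at $M(\cdot,\tau^*,\alpha)$ is finite and is at least its value at $M(\cdot,\xi)$ for every approximate design $\xi$. (i) If $\tau^*$ is Bayes optimal under $\psi_0$, then $$\int \pi_J(\theta,\tau^*,\alpha)\,\pi_0(\theta,\tau^*,\alpha)\,d\Pi(\theta)\ \ge\ \tfrac16 .$$ (ii) If $\tau^*$ is Bayes optimal under $\psi_{-1}$, then $$\int \big(\pi_J(\theta,\tau^*,\alpha)\,\pi_0(\theta,\tau^*,\alpha)\big)^{-1}\,d\Pi(\theta)\ \le\ 6 .$$ -/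

import Mathlib

open MeasureTheory Filter Topology

noncomputable section

namespace GPCM

/-- The cumulative logit `∑_{s=1}^{j} α_s (θ - τ_s)` of category `j ∈ {0, …, J}`. The thresholds and
discriminations `τ_1, …, τ_J`, `α_1, …, α_J` are indexed by `Fin J` (so `s : Fin J` stands for the
index `s + 1`), the categories by `Fin (J + 1)`. -/
def cumLogit {J : ℕ} (α τ : Fin J → ℝ) (θ : ℝ) (j : Fin (J + 1)) : ℝ :=
  ∑ s : Fin J with s.val < j.val, α s * (θ - τ s)

/-- The probability `π_j(θ, τ, α)` of response category `j` in the generalized partial credit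
model. -/
def catProb {J : ℕ} (α τ : Fin J → ℝ) (θ : ℝ) (j : Fin (J + 1)) : ℝ :=
  Real.exp (cumLogit α τ θ j) / ∑ k : Fin (J + 1), Real.exp (cumLogit α τ θ k)

/-- The score `d/dθ log π_j(θ, τ, α)` of an item whose observed response is `j`. -/
def score {J : ℕ} (α τ : Fin J → ℝ) (θ : ℝ) (j : Fin (J + 1)) : ℝ :=
  deriv (fun x : ℝ => Real.log (catProb α τ x j)) θ

/-- The Fisher information `M(θ, τ, α)` of a single item: the variance of the score when the
response `Y` has law `(π_0, …, π_J)`. -/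
def fisherInfo {J : ℕ} (α τ : Fin J → ℝ) (θ : ℝ) : ℝ :=
  ∑ j : Fin (J + 1), catProb α τ θ j * score α τ θ j ^ 2
    - (∑ j : Fin (J + 1), catProb α τ θ j * score α τ θ j) ^ 2

/-- The threshold vectors `θ₀ + (α_J c, 0, …, 0, -α_1 c)`, whose formal limit as `c → ∞` is the
limiting threshold `τ*` for the ability `θ₀`. For `J = 1` the two contributions cancel, and the
vector is the single threshold `θ₀`. -/
def thresholdSeq {J : ℕ} (α : Fin J → ℝ) (θ₀ c : ℝ) : Fin J → ℝ := fun s =>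
  θ₀ + (if s.val = 0 then α s.rev * c else 0) - (if s.val + 1 = J then α s.rev * c else 0)

/-- The probability `π_j(θ, τ*, α)` of category `j` at the limiting threshold. -/
def limitCatProb {J : ℕ} (α : Fin J → ℝ) (θ₀ θ : ℝ) (j : Fin (J + 1)) : ℝ :=
  limUnder atTop (fun c : ℝ => catProb α (thresholdSeq α θ₀ c) θ j)

/-- The Fisher information `M(θ, τ*, α)` at the limiting threshold. -/
def limitInfo {J : ℕ} (α : Fin J → ℝ) (θ₀ θ : ℝ) : ℝ :=
  limUnder atTop (fun c : ℝ => fisherInfo α (thresholdSeq α θ₀ c) θ)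

/-- An approximate design for items with fixed discrimination: a probability distribution with
finite support on the threshold vectors in `ℝ^J`. -/
structure Design (J : ℕ) where
  weight : (Fin J → ℝ) →₀ ℝ
  nonneg : ∀ τ, 0 ≤ weight τ
  total : (weight.sum fun _ w => w) = 1

/-- The Fisher information `M(θ, ξ)` (per item) of an approximate design. -/
def Design.info {J : ℕ} (ξ : Design J) (α : Fin J → ℝ) (θ : ℝ) : ℝ :=
  ξ.weight.sum fun τ w => w * fisherInfo α τ θ

/-- The utility averaged by the criterion `ψ_0 = E [log M]`. -/
def utilZero (m : ℝ) : ℝ := Real.log m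

/-- The utility averaged by the criterion `ψ_{-1} = -E [M⁻¹]`. -/
def utilNegOne (m : ℝ) : ℝ := -m⁻¹

/-- The Bayesian design criterion `E [u (M(θ))]` under the weight distribution `μ` of `θ`. -/
def criterion (u : ℝ → ℝ) (μ : Measure ℝ) (M : ℝ → ℝ) : ℝ := ∫ θ, u (M θ) ∂μ

/-- For fixed discrimination `α`, the limiting threshold `τ*` is Bayes optimal: its criterion value
is finite and no approximate design has a larger one. For both utilities above, `u (M(θ, ξ))` is
bounded above in `θ`, so a design at which it is not integrable has criterion value `-∞` and cannot
be better. -/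
def LimitBayesOptimal {J : ℕ} (u : ℝ → ℝ) (μ : Measure ℝ) (α : Fin J → ℝ) (θ₀ : ℝ) : Prop :=
  Integrable (fun θ => u (limitInfo α θ₀ θ)) μ ∧
    ∀ ξ : Design J, Integrable (fun θ => u (ξ.info α θ)) μ →
      criterion u μ (ξ.info α) ≤ criterion u μ (limitInfo α θ₀)

/-- `μ` is symmetric around `θ₀`. -/
def SymmetricAround (μ : Measure ℝ) (θ₀ : ℝ) : Prop :=
  μ.map (fun θ => 2 * θ₀ - θ) = μ

theorem cumLogit_thresholdSeq {J : ℕ} (hJ : 1 ≤ J) (α : Fin J → ℝ) (θ₀ c θ : ℝ)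
    (j : Fin (J + 1)) :
    cumLogit α (thresholdSeq α θ₀ c) θ j = (∑ s : Fin J with s.val < j.val, α s * (θ - θ₀))
      - (if 0 < j.val ∧ j.val < J then α ⟨0, hJ⟩ * α ⟨J - 1, by omega⟩ * c else 0) := by
  have hs : ∀ s : Fin J, α s * (θ - thresholdSeq α θ₀ c s) = α s * (θ - θ₀)
      - (if s = (⟨0, hJ⟩ : Fin J) then α ⟨0, hJ⟩ * α ⟨J - 1, by omega⟩ * c else 0)
      + (if s = (⟨J - 1, by omega⟩ : Fin J) then α ⟨0, hJ⟩ * α ⟨J - 1, by omega⟩ * c else 0) := by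
    intro s
    have h0 : (⟨0, hJ⟩ : Fin J).rev = ⟨J - 1, by omega⟩ := by ext; simp [Fin.rev]
    have h1 : (⟨J - 1, by omega⟩ : Fin J).rev = ⟨0, hJ⟩ := by ext; simp [Fin.rev]; omega
    have e0 : (s.val = 0) = (s = (⟨0, hJ⟩ : Fin J)) := by simp [Fin.ext_iff]
    have e1 : (s.val + 1 = J) = (s = (⟨J - 1, by omega⟩ : Fin J)) := by
      simp only [Fin.ext_iff, eq_iff_iff]; omega
    simp only [thresholdSeq, e0, e1]
    have a1 : s = (⟨0, hJ⟩ : Fin J) → α s = α ⟨0, hJ⟩ ∧ α s.rev = α ⟨J - 1, by omega⟩ := by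
      rintro rfl; exact ⟨rfl, by rw [h0]⟩
    have b1 : s = (⟨J - 1, by omega⟩ : Fin J) →
        α s = α ⟨J - 1, by omega⟩ ∧ α s.rev = α ⟨0, hJ⟩ := by
      rintro rfl; exact ⟨rfl, by rw [h1]⟩
    split_ifs with a b b
    · ring
    · rw [(a1 a).1, (a1 a).2]; ring
    · rw [(b1 b).1, (b1 b).2]; ring
    · ring
  unfold cumLogit
  rw [Finset.sum_congr rfl (fun s _ => hs s), Finset.sum_add_distrib, Finset.sum_sub_distrib,
    Finset.sum_ite_eq', Finset.sum_ite_eq']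
  have hj := j.isLt
  simp only [Finset.mem_filter, Finset.mem_univ, true_and]
  by_cases a : 0 < j.val <;> by_cases b : j.val < J
  · have : ¬ (J - 1 < j.val) := by omega
    simp [a, b, this]
  · have : (J - 1 < j.val) := by omega
    simp [a, b, this]
  · have : ¬ (J - 1 < j.val) := by omega
    simp [a, this]
  · omega

/-- The limits that define the category probabilities at `τ*` exist. -/
theorem exists_tendsto_catProb {J : ℕ} (hJ : 1 ≤ J) (α : Fin J → ℝ) (hα : ∀ s, 0 < α s)
    (θ₀ θ : ℝ) (j : Fin (J + 1)) :
    ∃ p, Tendsto (fun c : ℝ => catProb α (thresholdSeq α θ₀ c) θ j) atTop (𝓝 p) := by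
  have key : ∀ k : Fin (J + 1), ∃ e, Tendsto
      (fun c : ℝ => Real.exp (cumLogit α (thresholdSeq α θ₀ c) θ k)) atTop (𝓝 e) := by
    intro k
    simp only [cumLogit_thresholdSeq hJ]
    by_cases h : 0 < k.val ∧ k.val < J
    · simp only [if_pos h]
      refine ⟨0, Real.tendsto_exp_atBot.comp ?_⟩
      have h2 : Tendsto (fun c : ℝ => α ⟨0, hJ⟩ * α ⟨J - 1, by omega⟩ * c) atTop atTop :=
        tendsto_id.const_mul_atTop (mul_pos (hα _) (hα _))
      exact tendsto_atBot_add_const_left _ _ (tendsto_neg_atTop_atBot.comp h2)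
    · simp only [if_neg h]
      exact ⟨_, tendsto_const_nhds⟩
  choose e he using key
  refine ⟨e j / ∑ k, e k, (he j).div (tendsto_finsetSum _ fun k _ => he k) ?_⟩
  have h0 : e 0 = 1 := by
    refine tendsto_nhds_unique (he 0) ?_
    simp [cumLogit]
  have hnn : ∀ k, 0 ≤ e k := fun k =>
    ge_of_tendsto' (he k) fun c => (Real.exp_pos _).le
  have := Finset.single_le_sum (fun k _ => hnn k) (Finset.mem_univ (0 : Fin (J + 1)))
  linarith

theorem score_eq {J : ℕ} (α τ : Fin J → ℝ) (θ : ℝ) (j : Fin (J + 1)) :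
    score α τ θ j = (∑ s : Fin J with s.val < j.val, α s)
      - ∑ k : Fin (J + 1), (∑ s : Fin J with s.val < k.val, α s) * catProb α τ θ k := by
  have hc : ∀ k : Fin (J + 1), HasDerivAt (fun x => cumLogit α τ x k)
      (∑ s : Fin J with s.val < k.val, α s) θ := by
    intro k
    unfold cumLogit
    refine HasDerivAt.fun_sum fun s _ => ?_
    simpa using ((hasDerivAt_id θ).sub_const (τ s)).const_mul (α s)
  have hpos : ∀ x, 0 < ∑ k : Fin (J + 1), Real.exp (cumLogit α τ x k) := fun x =>
    Finset.sum_pos (fun k _ => Real.exp_pos _) Finset.univ_nonempty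
  have hl : (fun x => Real.log (catProb α τ x j)) = fun x => cumLogit α τ x j
      - Real.log (∑ k : Fin (J + 1), Real.exp (cumLogit α τ x k)) := by
    funext x
    rw [catProb, Real.log_div (Real.exp_pos _).ne' (hpos x).ne', Real.log_exp]
  have hz := (HasDerivAt.fun_sum (u := Finset.univ) fun k _ => (hc k).exp).log (hpos θ).ne'
  rw [score, hl, ((hc j).fun_sub hz).deriv, Finset.sum_div]
  congr 1
  refine Finset.sum_congr rfl fun k _ => ?_
  rw [catProb]; ring

/-- The limits that define the Fisher information at `τ*` exist. -/
theorem exists_tendsto_fisherInfo {J : ℕ} (hJ : 1 ≤ J) (α : Fin J → ℝ) (hα : ∀ s, 0 < α s)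
    (θ₀ θ : ℝ) :
    ∃ m, Tendsto (fun c : ℝ => fisherInfo α (thresholdSeq α θ₀ c) θ) atTop (𝓝 m) := by
  choose p hp using exists_tendsto_catProb hJ α hα θ₀ θ
  simp only [fisherInfo, score_eq]
  have hs : ∀ j : Fin (J + 1), Tendsto (fun c : ℝ => (∑ s : Fin J with s.val < j.val, α s)
      - ∑ k : Fin (J + 1), (∑ s : Fin J with s.val < k.val, α s)
        * catProb α (thresholdSeq α θ₀ c) θ k) atTop (𝓝 _) := fun j =>
    tendsto_const_nhds.sub (tendsto_finsetSum _ fun k _ => (hp k).const_mul _)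
  exact ⟨_, (tendsto_finsetSum _ fun j _ => (hp j).mul ((hs j).pow 2)).sub
    ((tendsto_finsetSum _ fun j _ => (hp j).mul (hs j)).pow 2)⟩

end GPCM

end

/-!
Write `A = ∑ α_s`, `x = A (θ - θ₀)` and `C = cosh x`. At the limiting threshold only the two extreme
categories survive, the item is a logistic one with slope `A`, and
`π_J π_0 = 1 / (2 (1 + C))`, `M(θ, τ*) = A² / (2 (1 + C))`.

The limiting threshold is compared with the design that puts mass `1 / 2` on each of the two limiting
thresholds belonging to `θ₀ - d / A` and `θ₀ + d / A`. With `D = cosh d`, its information is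
`A² (1 + C D) / (2 (C + D)²)`. This is only a limit of genuine designs, but the information of the
designs at finite `c` lies between `M(θ, τ*) / ((J + 1)² D)` and `A²`, so dominated convergence turns
optimality of `τ*` into an inequality between the limiting criterion values
(`LimitBayesOptimal.integral_pairWeight_le`).

The quotient of the two informations satisfies
`(C + D)² / ((1 + C D) (1 + C)) ≤ 1 + (D - 1) (2 - C) / (1 + C) + (D - 1)²`.
Dividing the criterion inequality by `D - 1` and letting `D → 1` yields
`∫ (2 - C) / (1 + C) ≥ 0` under `ψ_0` (through `log y ≥ 1 - y⁻¹`) and `∫ (2 - C) ≥ 0` under `ψ_{-1}`,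
which are the two claims. In other words, the second derivative of the criterion along
the splitting of `τ*` cannot be positive.
-/

open MeasureTheory Filter Topology

noncomputable section

namespace GPCM

/-! ### The information of a single item -/

/-- The partial sum `α_1 + ⋯ + α_j` of the discriminations, i.e. the weight of category `j` in the
sufficient statistic for `θ`. -/
def cumDisc {J : ℕ} (α : Fin J → ℝ) (j : Fin (J + 1)) : ℝ :=
  ∑ s : Fin J with s.val < j.val, α s

section

variable {J : ℕ} {α : Fin J → ℝ}

theorem cumDisc_zero : cumDisc α 0 = 0 := by simp [cumDisc]

theorem cumDisc_last : cumDisc α (Fin.last J) = ∑ s, α s := by simp [cumDisc]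

theorem cumDisc_nonneg (hα : ∀ s, 0 < α s) (j : Fin (J + 1)) : 0 ≤ cumDisc α j :=
  Finset.sum_nonneg fun s _ => (hα s).le

theorem cumDisc_le (hα : ∀ s, 0 < α s) (j : Fin (J + 1)) : cumDisc α j ≤ ∑ s, α s :=
  Finset.sum_le_sum_of_subset_of_nonneg (Finset.filter_subset _ _) fun s _ _ => (hα s).le

theorem sum_disc_pos (hJ : 1 ≤ J) (hα : ∀ s, 0 < α s) : 0 < ∑ s, α s :=
  Finset.sum_pos (fun s _ => hα s) ⟨⟨0, hJ⟩, Finset.mem_univ _⟩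

theorem zero_ne_last (hJ : 1 ≤ J) : (0 : Fin (J + 1)) ≠ Fin.last J := by
  intro h
  have := congrArg Fin.val h
  simp at this
  omega

theorem sum_exp_pos (α τ : Fin J → ℝ) (θ : ℝ) :
    0 < ∑ k : Fin (J + 1), Real.exp (cumLogit α τ θ k) :=
  Finset.sum_pos (fun _ _ => Real.exp_pos _) Finset.univ_nonempty

theorem catProb_pos (α τ : Fin J → ℝ) (θ : ℝ) (j : Fin (J + 1)) : 0 < catProb α τ θ j :=
  div_pos (Real.exp_pos _) (sum_exp_pos α τ θ)

theorem sum_catProb (α τ : Fin J → ℝ) (θ : ℝ) : ∑ j, catProb α τ θ j = 1 := by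
  simp only [catProb, ← Finset.sum_div]
  exact div_self (sum_exp_pos α τ θ).ne'

theorem continuous_catProb (α τ : Fin J → ℝ) (j : Fin (J + 1)) :
    Continuous fun θ => catProb α τ θ j := by
  have hc : ∀ k : Fin (J + 1), Continuous fun θ => cumLogit α τ θ k := fun k => by
    unfold cumLogit
    fun_prop
  unfold catProb
  exact (hc j).rexp.div (continuous_finsetSum _ fun k _ => (hc k).rexp)
    fun θ => (sum_exp_pos α τ θ).ne'

/-- The Fisher information is the variance of the cumulative discrimination of the response. -/
theorem fisherInfo_eq (α τ : Fin J → ℝ) (θ : ℝ) :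
    fisherInfo α τ θ = ∑ j, catProb α τ θ j * cumDisc α j ^ 2
      - (∑ j, catProb α τ θ j * cumDisc α j) ^ 2 := by
  set m := ∑ j, catProb α τ θ j * cumDisc α j with hm
  have hs : ∀ j, score α τ θ j = cumDisc α j - m := fun j => by
    rw [score_eq, hm]
    simp only [cumDisc, mul_comm]
  have h1 : ∑ j, catProb α τ θ j * (cumDisc α j - m) = 0 := by
    simp only [mul_sub, Finset.sum_sub_distrib, ← Finset.sum_mul, sum_catProb, ← hm]
    ring
  have h2 : ∑ j, catProb α τ θ j * (cumDisc α j - m) ^ 2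
      = ∑ j, catProb α τ θ j * cumDisc α j ^ 2 - m ^ 2 := by
    have : ∀ j, catProb α τ θ j * (cumDisc α j - m) ^ 2 = catProb α τ θ j * cumDisc α j ^ 2
        - 2 * m * (catProb α τ θ j * cumDisc α j) + catProb α τ θ j * m ^ 2 := fun j => by ring
    simp only [this, Finset.sum_add_distrib, Finset.sum_sub_distrib, ← Finset.mul_sum,
      ← Finset.sum_mul, sum_catProb, ← hm]
    ring
  simp only [fisherInfo, hs, h1, h2]
  ring

theorem continuous_fisherInfo (α τ : Fin J → ℝ) : Continuous fun θ => fisherInfo α τ θ := by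
  simp only [fisherInfo_eq]
  have := continuous_catProb α τ
  fun_prop

theorem fisherInfo_le (hα : ∀ s, 0 < α s) (τ : Fin J → ℝ) (θ : ℝ) :
    fisherInfo α τ θ ≤ (∑ s, α s) ^ 2 := by
  rw [fisherInfo_eq]
  have : ∑ j, catProb α τ θ j * cumDisc α j ^ 2 ≤ ∑ j, catProb α τ θ j * (∑ s, α s) ^ 2 :=
    Finset.sum_le_sum fun j _ => mul_le_mul_of_nonneg_left
      (pow_le_pow_left₀ (cumDisc_nonneg hα j) (cumDisc_le hα j) 2) (catProb_pos α τ θ j).le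
  rw [← Finset.sum_mul, sum_catProb, one_mul] at this
  nlinarith [sq_nonneg (∑ j, catProb α τ θ j * cumDisc α j)]

/-- The contribution of the two extreme categories to the variance. -/
theorem le_fisherInfo (hJ : 1 ≤ J) (α τ : Fin J → ℝ) (θ : ℝ) :
    (∑ s, α s) ^ 2 * (catProb α τ θ (Fin.last J) * catProb α τ θ 0) ≤ fisherInfo α τ θ := by
  set m := ∑ j, catProb α τ θ j * cumDisc α j with hm
  have hv : fisherInfo α τ θ = ∑ j, catProb α τ θ j * (cumDisc α j - m) ^ 2 := by
    have : ∀ j, catProb α τ θ j * (cumDisc α j - m) ^ 2 = catProb α τ θ j * cumDisc α j ^ 2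
        - 2 * m * (catProb α τ θ j * cumDisc α j) + catProb α τ θ j * m ^ 2 := fun j => by ring
    simp only [fisherInfo_eq, this, Finset.sum_add_distrib, Finset.sum_sub_distrib,
      ← Finset.mul_sum, ← Finset.sum_mul, sum_catProb, ← hm]
    ring
  have h2 : ∑ j ∈ {0, Fin.last J}, catProb α τ θ j * (cumDisc α j - m) ^ 2
      ≤ fisherInfo α τ θ := by
    rw [hv]
    exact Finset.sum_le_sum_of_subset_of_nonneg (Finset.subset_univ _) fun j _ _ =>
      mul_nonneg (catProb_pos α τ θ j).le (sq_nonneg _)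
  have h1 : ∑ j ∈ {0, Fin.last J}, catProb α τ θ j ≤ 1 := by
    rw [← sum_catProb α τ θ]
    exact Finset.sum_le_sum_of_subset_of_nonneg (Finset.subset_univ _) fun j _ _ =>
      (catProb_pos α τ θ j).le
  rw [Finset.sum_pair (zero_ne_last hJ)] at h1 h2
  rw [cumDisc_zero, cumDisc_last] at h2
  have h0 := catProb_pos α τ θ 0
  have hL := catProb_pos α τ θ (Fin.last J)
  generalize catProb α τ θ 0 = p at *
  generalize catProb α τ θ (Fin.last J) = q at *
  generalize ∑ s, α s = A at *
  -- Cauchy–Schwarz for the two-point distribution with masses `p` and `q`, `p + q ≤ 1`.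
  have h3 : (p + q) * (p * (0 - m) ^ 2 + q * (A - m) ^ 2)
      = A ^ 2 * (q * p) + (p * m - q * (A - m)) ^ 2 := by ring
  have h4 : 0 ≤ p * (0 - m) ^ 2 + q * (A - m) ^ 2 := by positivity
  nlinarith [sq_nonneg (p * m - q * (A - m)), mul_le_mul_of_nonneg_right h1 h4]

/-! ### The limit `c → ∞` -/

/-- The logistic density `π_J π_0 = e^x / (1 + e^x)²` of the limiting item, as a function of
`x = A (θ - θ₀)`. -/
def logisticWeight (x : ℝ) : ℝ := 1 / (2 * (1 + Real.cosh x))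

theorem logisticWeight_pos (x : ℝ) : 0 < logisticWeight x := by
  have := Real.cosh_pos x
  unfold logisticWeight
  positivity

theorem logisticWeight_eq (x : ℝ) : logisticWeight x = Real.exp x / (1 + Real.exp x) ^ 2 := by
  have h := Real.exp_pos x
  rw [logisticWeight, Real.cosh_eq, Real.exp_neg]
  field_simp
  ring

theorem cumLogit_thresholdSeq_zero (α : Fin J → ℝ) (θ₀ c θ : ℝ) :
    cumLogit α (thresholdSeq α θ₀ c) θ 0 = 0 := by simp [cumLogit]

theorem cumLogit_thresholdSeq_last (hJ : 1 ≤ J) (α : Fin J → ℝ) (θ₀ c θ : ℝ) :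
    cumLogit α (thresholdSeq α θ₀ c) θ (Fin.last J) = (∑ s, α s) * (θ - θ₀) := by
  rw [cumLogit_thresholdSeq hJ]
  simp [Finset.sum_mul]

/-- Category probabilities of the limiting item: a logistic model in the two extreme categories. -/
theorem tendsto_catProb (hJ : 1 ≤ J) (hα : ∀ s, 0 < α s) (θ₀ θ : ℝ) (j : Fin (J + 1)) :
    Tendsto (fun c : ℝ => catProb α (thresholdSeq α θ₀ c) θ j) atTop
      (𝓝 (((if j = 0 then 1 else 0)
        + (if j = Fin.last J then Real.exp ((∑ s, α s) * (θ - θ₀)) else 0))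
          / (1 + Real.exp ((∑ s, α s) * (θ - θ₀))))) := by
  set E := Real.exp ((∑ s, α s) * (θ - θ₀)) with hE
  have h0L := zero_ne_last hJ
  have key : ∀ k : Fin (J + 1), Tendsto
      (fun c : ℝ => Real.exp (cumLogit α (thresholdSeq α θ₀ c) θ k)) atTop
      (𝓝 ((if k = 0 then 1 else 0) + (if k = Fin.last J then E else 0))) := by
    intro k
    rcases eq_or_ne k 0 with rfl | hk0
    · simp [cumLogit_thresholdSeq_zero, h0L]
    rcases eq_or_ne k (Fin.last J) with rfl | hkL
    · simp [cumLogit_thresholdSeq_last hJ, h0L.symm, hE]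
    have hm : 0 < k.val ∧ k.val < J := by
      have h1 : k.val ≠ 0 := fun h => hk0 (Fin.ext h)
      have h2 : k.val ≠ J := fun h => hkL (Fin.ext h)
      have := k.isLt
      omega
    simp only [cumLogit_thresholdSeq hJ, if_pos hm, if_neg hk0, if_neg hkL, add_zero]
    refine Real.tendsto_exp_atBot.comp ?_
    have h2 : Tendsto (fun c : ℝ => α ⟨0, hJ⟩ * α ⟨J - 1, by omega⟩ * c) atTop atTop :=
      tendsto_id.const_mul_atTop (mul_pos (hα _) (hα _))
    exact tendsto_atBot_add_const_left _ _ (tendsto_neg_atTop_atBot.comp h2)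
  have hsum : ∑ k : Fin (J + 1), ((if k = 0 then 1 else 0) + (if k = Fin.last J then E else 0))
      = 1 + E := by simp [Finset.sum_add_distrib]
  have hE0 : 0 < E := Real.exp_pos _
  have h := tendsto_finsetSum Finset.univ fun k _ => key k
  rw [hsum] at h
  exact (key j).div h (by positivity)

theorem limitCatProb_mul_eq (hJ : 1 ≤ J) (hα : ∀ s, 0 < α s) (θ₀ θ : ℝ) :
    limitCatProb α θ₀ θ (Fin.last J) * limitCatProb α θ₀ θ 0
      = logisticWeight ((∑ s, α s) * (θ - θ₀)) := by
  have h0L := zero_ne_last hJ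
  rw [limitCatProb, limitCatProb, (tendsto_catProb hJ hα θ₀ θ _).limUnder_eq,
    (tendsto_catProb hJ hα θ₀ θ _).limUnder_eq, logisticWeight_eq, if_neg h0L.symm, if_pos rfl,
    if_pos rfl, if_neg h0L]
  field_simp
  ring

theorem tendsto_fisherInfo (hJ : 1 ≤ J) (hα : ∀ s, 0 < α s) (θ₀ θ : ℝ) :
    Tendsto (fun c : ℝ => fisherInfo α (thresholdSeq α θ₀ c) θ) atTop
      (𝓝 ((∑ s, α s) ^ 2 * logisticWeight ((∑ s, α s) * (θ - θ₀)))) := by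
  simp only [fisherInfo_eq]
  have hp := tendsto_catProb hJ hα θ₀ θ
  have h := (tendsto_finsetSum Finset.univ fun j _ => (hp j).mul_const (cumDisc α j ^ 2)).sub
    ((tendsto_finsetSum Finset.univ fun j _ => (hp j).mul_const (cumDisc α j)).pow 2)
  convert h using 2
  have hE := Real.exp_pos ((∑ s, α s) * (θ - θ₀))
  rw [logisticWeight_eq]
  simp only [add_div, add_mul, Finset.sum_add_distrib, ite_div, zero_div, ite_mul, zero_mul,
    Finset.sum_ite_eq', Finset.mem_univ, if_true, cumDisc_zero, cumDisc_last]
  field_simp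
  ring

theorem limitInfo_eq (hJ : 1 ≤ J) (hα : ∀ s, 0 < α s) (θ₀ θ : ℝ) :
    limitInfo α θ₀ θ = (∑ s, α s) ^ 2 * logisticWeight ((∑ s, α s) * (θ - θ₀)) :=
  (tendsto_fisherInfo hJ hα θ₀ θ).limUnder_eq

/-- The intermediate categories lower `π_J π_0` at most by the factor `(J + 1)²`, whatever `c ≥ 0`:
each of their exponentials is at most the larger one of the two extreme categories. -/
theorem le_catProb_mul (hJ : 1 ≤ J) (hα : ∀ s, 0 < α s) (θ₀ θ : ℝ) {c : ℝ} (hc : 0 ≤ c) :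
    logisticWeight ((∑ s, α s) * (θ - θ₀)) / (J + 1) ^ 2
      ≤ catProb α (thresholdSeq α θ₀ c) θ (Fin.last J)
        * catProb α (thresholdSeq α θ₀ c) θ 0 := by
  set x := (∑ s, α s) * (θ - θ₀) with hx
  have hterm : ∀ k : Fin (J + 1),
      Real.exp (cumLogit α (thresholdSeq α θ₀ c) θ k) ≤ 1 + Real.exp x := by
    intro k
    have hl : cumLogit α (thresholdSeq α θ₀ c) θ k ≤ cumDisc α k * (θ - θ₀) := by
      rw [cumLogit_thresholdSeq hJ, ← Finset.sum_mul]
      have := mul_nonneg (mul_pos (hα ⟨0, hJ⟩) (hα ⟨J - 1, by omega⟩)).le hc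
      unfold cumDisc
      split_ifs <;> linarith
    rcases le_total 0 (θ - θ₀) with ht | ht
    · have := Real.exp_le_exp.2 (hl.trans (mul_le_mul_of_nonneg_right (cumDisc_le hα k) ht))
      linarith
    · have := Real.exp_le_exp.2 (hl.trans (mul_nonpos_of_nonneg_of_nonpos
        (cumDisc_nonneg hα k) ht))
      rw [Real.exp_zero] at this
      linarith [Real.exp_pos x]
  have hZ : ∑ k : Fin (J + 1), Real.exp (cumLogit α (thresholdSeq α θ₀ c) θ k)
      ≤ (J + 1) * (1 + Real.exp x) := by
    refine (Finset.sum_le_sum fun k _ => hterm k).trans_eq ?_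
    simp [mul_add]
  have hZ0 := sum_exp_pos α (thresholdSeq α θ₀ c) θ
  rw [catProb, catProb, cumLogit_thresholdSeq_zero, cumLogit_thresholdSeq_last hJ, ← hx,
    Real.exp_zero, logisticWeight_eq, div_mul_div_comm, mul_one, div_div, ← mul_pow, ← sq]
  refine div_le_div_of_nonneg_left (Real.exp_pos x).le (by positivity) ?_
  rw [mul_comm]
  exact pow_le_pow_left₀ hZ0.le hZ 2

/-! ### Splitting the limiting threshold -/

/-- The design with mass `1 / 2` at each of two threshold vectors. -/
def pairDesign (τ τ' : Fin J → ℝ) : Design J where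
  weight := Finsupp.single τ (1 / 2) + Finsupp.single τ' (1 / 2)
  nonneg σ := by
    classical
    simp only [Finsupp.add_apply, Finsupp.single_apply]
    split_ifs <;> norm_num
  total := by
    rw [Finsupp.sum_add_index' (fun _ => rfl) (fun _ _ _ => rfl), Finsupp.sum_single_index rfl,
      Finsupp.sum_single_index rfl]
    norm_num

theorem pairDesign_info (τ τ' α : Fin J → ℝ) (θ : ℝ) :
    (pairDesign τ τ').info α θ = (fisherInfo α τ θ + fisherInfo α τ' θ) / 2 := by
  unfold Design.info pairDesign
  rw [Finsupp.sum_add_index' (fun _ => by ring) (fun _ _ _ => by ring),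
    Finsupp.sum_single_index (by ring), Finsupp.sum_single_index (by ring)]
  ring

/-- The mean of the logistic density at `x - d` and `x + d`, in terms of `C = cosh x` and
`D = cosh d`. -/
def pairWeight (C D : ℝ) : ℝ := (1 + C * D) / (2 * (C + D) ^ 2)

theorem pairWeight_cosh (x d : ℝ) :
    (logisticWeight (x - d) + logisticWeight (x + d)) / 2
      = pairWeight (Real.cosh x) (Real.cosh d) := by
  have h1 := Real.cosh_pos (x - d)
  have h2 := Real.cosh_pos (x + d)
  have hC := Real.cosh_pos x
  have hD := Real.cosh_pos d
  have hprod : (1 + Real.cosh (x - d)) * (1 + Real.cosh (x + d))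
      = (Real.cosh x + Real.cosh d) ^ 2 := by
    rw [Real.cosh_sub, Real.cosh_add]
    nlinarith [Real.cosh_sq x, Real.cosh_sq d]
  have hsum : (1 + Real.cosh (x - d)) + (1 + Real.cosh (x + d))
      = 2 * (1 + Real.cosh x * Real.cosh d) := by
    rw [Real.cosh_sub, Real.cosh_add]
    ring
  have : logisticWeight (x - d) + logisticWeight (x + d)
      = ((1 + Real.cosh (x - d)) + (1 + Real.cosh (x + d)))
        / (2 * ((1 + Real.cosh (x - d)) * (1 + Real.cosh (x + d)))) := by
    unfold logisticWeight
    field_simp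
    ring
  rw [this, hprod, hsum, pairWeight]
  field_simp

theorem logisticWeight_div_le_pairWeight (x : ℝ) {D : ℝ} (hD : 1 ≤ D) :
    logisticWeight x / D ≤ pairWeight (Real.cosh x) D := by
  have hC := Real.one_le_cosh x
  unfold logisticWeight pairWeight
  generalize Real.cosh x = C at *
  rw [div_div, div_le_div_iff₀ (by positivity) (by positivity)]
  have h1 : C + D ≤ 1 + C * D := by nlinarith
  have h2 : C + D ≤ D * (1 + C) := by nlinarith
  nlinarith [mul_le_mul h1 h2 (by positivity) (by positivity)]

/-- Optimality of `τ*` with respect to its splitting. The utility `u` enters through monotonicity and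
continuity on the positive reals, and through the stability of integrability under rescaling. -/
theorem LimitBayesOptimal.integral_pairWeight_le (hJ : 1 ≤ J) (hα : ∀ s, 0 < α s)
    {μ : Measure ℝ} [IsProbabilityMeasure μ] {θ₀ : ℝ} {u : ℝ → ℝ}
    (hu : MonotoneOn u (Set.Ioi 0)) (huc : ContinuousOn u (Set.Ioi 0))
    (hui : ∀ K : ℝ, 0 < K → Integrable (fun θ => u (limitInfo α θ₀ θ / K)) μ)
    (hopt : LimitBayesOptimal u μ α θ₀) {D : ℝ} (hD : 1 ≤ D) :
    Integrable (fun θ => u ((∑ s, α s) ^ 2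
        * pairWeight (Real.cosh ((∑ s, α s) * (θ - θ₀))) D)) μ ∧
      ∫ θ, u ((∑ s, α s) ^ 2 * pairWeight (Real.cosh ((∑ s, α s) * (θ - θ₀))) D) ∂μ
        ≤ ∫ θ, u ((∑ s, α s) ^ 2 * logisticWeight ((∑ s, α s) * (θ - θ₀))) ∂μ := by
  have hA := sum_disc_pos hJ hα
  obtain ⟨d, rfl⟩ : ∃ d, D = Real.cosh d := ⟨Real.arcosh D, (Real.cosh_arcosh hD).symm⟩
  set A := ∑ s, α s with hAdef
  set D := Real.cosh d
  have hpair : ∀ x, (logisticWeight (x - d) + logisticWeight (x + d)) / 2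
      = pairWeight (Real.cosh x) D := fun x => pairWeight_cosh x d
  set w : ℝ → ℝ := fun θ => A ^ 2 * pairWeight (Real.cosh (A * (θ - θ₀))) D with hw
  set ξ : ℝ → Design J := fun c =>
    pairDesign (thresholdSeq α (θ₀ + d / A) c) (thresholdSeq α (θ₀ - d / A) c) with hξ
  have hminus : ∀ θ, A * (θ - (θ₀ + d / A)) = A * (θ - θ₀) - d := fun θ => by
    field_simp
    ring
  have hplus : ∀ θ, A * (θ - (θ₀ - d / A)) = A * (θ - θ₀) + d := fun θ => by
    field_simp
    ring
  have hlim : ∀ θ, Tendsto (fun c => (ξ c).info α θ) atTop (𝓝 (w θ)) := by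
    intro θ
    have h := ((tendsto_fisherInfo hJ hα (θ₀ + d / A) θ).add
      (tendsto_fisherInfo hJ hα (θ₀ - d / A) θ)).div_const 2
    simp only [hξ, pairDesign_info]
    convert h using 2
    rw [← hAdef, hminus, hplus]
    simp only [hw, ← hpair]
    ring
  set K : ℝ := (J + 1) ^ 2 * D with hK
  have hK0 : 0 < K := by positivity
  have hpos : ∀ θ, 0 < limitInfo α θ₀ θ / K := fun θ => by
    rw [limitInfo_eq hJ hα]
    have := logisticWeight_pos (A * (θ - θ₀))
    positivity
  have hlow : ∀ c, 0 ≤ c → ∀ θ, limitInfo α θ₀ θ / K ≤ (ξ c).info α θ := by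
    intro c hc θ
    have e1 := (mul_le_mul_of_nonneg_left (le_catProb_mul hJ hα (θ₀ + d / A) θ hc)
      (sq_nonneg A)).trans (le_fisherInfo hJ α (thresholdSeq α (θ₀ + d / A) c) θ)
    have e2 := (mul_le_mul_of_nonneg_left (le_catProb_mul hJ hα (θ₀ - d / A) θ hc)
      (sq_nonneg A)).trans (le_fisherInfo hJ α (thresholdSeq α (θ₀ - d / A) c) θ)
    rw [← hAdef, hminus] at e1
    rw [← hAdef, hplus] at e2
    have e3 := logisticWeight_div_le_pairWeight (A * (θ - θ₀)) hD
    rw [← hpair] at e3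
    have e4 : limitInfo α θ₀ θ / K
        = A ^ 2 / (J + 1) ^ 2 * (logisticWeight (A * (θ - θ₀)) / D) := by
      rw [limitInfo_eq hJ hα, ← hAdef, hK]
      field_simp
    have e5 := mul_le_mul_of_nonneg_left e3 (show (0 : ℝ) ≤ A ^ 2 / (J + 1) ^ 2 by positivity)
    rw [hξ, pairDesign_info, e4]
    refine e5.trans (le_trans (le_of_eq ?_) (div_le_div_of_nonneg_right (add_le_add e1 e2)
      (by norm_num : (0 : ℝ) ≤ 2)))
    ring
  have hup : ∀ c θ, (ξ c).info α θ ≤ A ^ 2 := fun c θ => by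
    rw [hξ, pairDesign_info]
    linarith [fisherInfo_le hα (thresholdSeq α (θ₀ + d / A) c) θ,
      fisherInfo_le hα (thresholdSeq α (θ₀ - d / A) c) θ]
  have hbound : ∀ m θ, limitInfo α θ₀ θ / K ≤ m → m ≤ A ^ 2 →
      ‖u m‖ ≤ |u (limitInfo α θ₀ θ / K)| + |u (A ^ 2)| := by
    intro m θ h1 h2
    have hm : 0 < m := (hpos θ).trans_le h1
    have a := hu (hpos θ) hm h1
    have b := hu hm (hm.trans_le h2 : 0 < A ^ 2) h2
    rw [Real.norm_eq_abs, abs_le]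
    constructor
    · linarith [neg_abs_le (u (limitInfo α θ₀ θ / K)), abs_nonneg (u (A ^ 2))]
    · linarith [le_abs_self (u (A ^ 2)), abs_nonneg (u (limitInfo α θ₀ θ / K))]
  have hg : Integrable (fun θ => |u (limitInfo α θ₀ θ / K)| + |u (A ^ 2)|) μ :=
    (hui K hK0).abs.add (integrable_const _)
  have hmeas : ∀ c, 0 ≤ c → AEStronglyMeasurable (fun θ => u ((ξ c).info α θ)) μ := by
    intro c hc
    refine (huc.comp_continuous ?_ fun θ => (hpos θ).trans_le (hlow c hc θ)).aestronglyMeasurable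
    refine Continuous.congr ?_ fun θ => (pairDesign_info _ _ α θ).symm
    exact ((continuous_fisherInfo _ _).add (continuous_fisherInfo _ _)).div_const 2
  have hwlow : ∀ θ, limitInfo α θ₀ θ / K ≤ w θ := fun θ =>
    ge_of_tendsto (hlim θ) ((eventually_ge_atTop 0).mono fun c hc => hlow c hc θ)
  have hwup : ∀ θ, w θ ≤ A ^ 2 := fun θ => le_of_tendsto' (hlim θ) fun c => hup c θ
  have hw0 : ∀ θ, 0 < w θ := fun θ => (hpos θ).trans_le (hwlow θ)
  have hwc : Continuous w := by
    have : ∀ θ, 2 * (Real.cosh (A * (θ - θ₀)) + D) ^ 2 ≠ 0 := fun θ => by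
      have := Real.cosh_pos (A * (θ - θ₀))
      positivity
    simp only [hw, pairWeight]
    refine continuous_const.mul (Continuous.div ?_ ?_ this) <;> fun_prop
  refine ⟨hg.mono' (huc.comp_continuous hwc hw0).aestronglyMeasurable
    (ae_of_all _ fun θ => hbound _ θ (hwlow θ) (hwup θ)), ?_⟩
  have hconv : Tendsto (fun c => ∫ θ, u ((ξ c).info α θ) ∂μ) atTop (𝓝 (∫ θ, u (w θ) ∂μ)) := by
    refine tendsto_integral_filter_of_dominated_convergence _
      ((eventually_ge_atTop 0).mono hmeas)
      ((eventually_ge_atTop 0).mono fun c hc =>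
        ae_of_all _ fun θ => hbound _ θ (hlow c hc θ) (hup c θ)) hg
      (ae_of_all _ fun θ => ?_)
    exact (huc.continuousAt (Ioi_mem_nhds (hw0 θ))).tendsto.comp (hlim θ)
  refine le_of_tendsto hconv ((eventually_ge_atTop 0).mono fun c hc => ?_)
  have h := hopt.2 (ξ c) (hg.mono' (hmeas c hc)
    (ae_of_all _ fun θ => hbound _ θ (hlow c hc θ) (hup c θ)))
  simpa only [criterion, limitInfo_eq hJ hα] using h

/-! ### Expansion at the unsplit threshold -/

/-- Second-order upper bound, in terms of `D - 1`, for the reciprocal information of the split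
threshold. -/
theorem inv_pairWeight_le {C D : ℝ} (hC : 1 ≤ C) (hD : 1 ≤ D) :
    (pairWeight C D)⁻¹ ≤ 2 * (1 + C) + 2 * (D - 1) * (2 - C) + 2 * (D - 1) ^ 2 * C := by
  have h1 : 0 < 1 + C * D := by positivity
  rw [pairWeight, inv_div, div_le_iff₀ h1]
  -- The difference of the two sides is
  -- `2 (D - 1)² (C (1 + C D) - (C - 1)²) = 2 (D - 1)² (C² (D - 1) + 3 C - 1)`.
  have h2 : 0 ≤ 2 * (D - 1) ^ 2 * (C ^ 2 * (D - 1) + 3 * C - 1) := by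
    have : 0 ≤ C ^ 2 * (D - 1) := mul_nonneg (sq_nonneg C) (by linarith)
    have : 0 ≤ C ^ 2 * (D - 1) + 3 * C - 1 := by linarith
    positivity
  nlinarith

theorem inv_logisticWeight (x : ℝ) : (logisticWeight x)⁻¹ = 2 * (1 + Real.cosh x) := by
  simp [logisticWeight]

theorem log_pairWeight_ge (x : ℝ) {D : ℝ} (hD : 1 ≤ D) :
    Real.log (logisticWeight x) + (D - 1) * (1 - 6 * logisticWeight x) - (D - 1) ^ 2
      ≤ Real.log (pairWeight (Real.cosh x) D) := by
  have hC := Real.one_le_cosh x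
  have hl := logisticWeight_pos x
  have hp : 0 < pairWeight (Real.cosh x) D := by
    unfold pairWeight
    positivity
  have h1 := Real.one_sub_inv_le_log_of_pos (div_pos hp hl)
  rw [Real.log_div hp.ne' hl.ne', inv_div, div_eq_mul_inv] at h1
  have h2 := mul_le_mul_of_nonneg_left (inv_pairWeight_le hC hD) hl.le
  have h3 : logisticWeight x * (2 * (1 + Real.cosh x) + 2 * (D - 1) * (2 - Real.cosh x)
      + 2 * (D - 1) ^ 2 * Real.cosh x)
      = 1 - (D - 1) * (1 - 6 * logisticWeight x)
        + (D - 1) ^ 2 * (1 - 2 * logisticWeight x) := by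
    unfold logisticWeight
    field_simp
    ring
  have h4 : 0 ≤ (D - 1) ^ 2 * (2 * logisticWeight x) := by positivity
  nlinarith

theorem continuous_logisticWeight : Continuous logisticWeight := by
  have : ∀ x, 2 * (1 + Real.cosh x) ≠ 0 := fun x => by
    have := Real.cosh_pos x
    positivity
  unfold logisticWeight
  exact continuous_const.div (by fun_prop) this

theorem logisticWeight_le_one (x : ℝ) : logisticWeight x ≤ 1 := by
  have := Real.one_le_cosh x
  unfold logisticWeight
  rw [div_le_one (by positivity)]
  linarith

/-- If `0 ≤ ε a + ε² b` for all `ε > 0`, then the linear coefficient is nonnegative. -/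
theorem nonneg_of_forall_pos_quadratic {a b : ℝ} (h : ∀ ε : ℝ, 0 < ε → 0 ≤ ε * a + ε ^ 2 * b) :
    0 ≤ a := by
  have ht : Tendsto (fun ε : ℝ => a + ε * b) (𝓝[>] 0) (𝓝 (a + 0 * b)) :=
    ((continuous_const.add (continuous_id.mul continuous_const)).tendsto 0).mono_left
      nhdsWithin_le_nhds
  rw [zero_mul, add_zero] at ht
  refine ge_of_tendsto ht (eventually_nhdsWithin_of_forall fun ε (hε : 0 < ε) => ?_)
  refine nonneg_of_mul_nonneg_right (a := ε) ?_ hε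
  linarith [h ε hε]

/-! ### The two criteria -/

theorem integrable_logisticWeight (A θ₀ : ℝ) (μ : Measure ℝ) [IsProbabilityMeasure μ] :
    Integrable (fun θ => logisticWeight (A * (θ - θ₀))) μ := by
  refine (integrable_const (1 : ℝ)).mono'
    (continuous_logisticWeight.comp (by fun_prop)).aestronglyMeasurable (ae_of_all _ fun θ => ?_)
  rw [Real.norm_of_nonneg (logisticWeight_pos _).le]
  exact logisticWeight_le_one _

theorem LimitBayesOptimal.one_sixth_le_integral (hJ : 1 ≤ J) (hα : ∀ s, 0 < α s)
    {μ : Measure ℝ} [IsProbabilityMeasure μ] {θ₀ : ℝ}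
    (hopt : LimitBayesOptimal utilZero μ α θ₀) :
    1 / 6 ≤ ∫ θ, logisticWeight ((∑ s, α s) * (θ - θ₀)) ∂μ := by
  have hA := sum_disc_pos hJ hα
  have hL : ∀ θ, 0 < limitInfo α θ₀ θ := fun θ => by
    rw [limitInfo_eq hJ hα]
    exact mul_pos (pow_pos hA 2) (logisticWeight_pos _)
  have key := fun (D : ℝ) (hD : 1 ≤ D) => hopt.integral_pairWeight_le hJ hα
    (fun a (ha : 0 < a) b _ hab => Real.log_le_log ha hab)
    (Real.continuousOn_log.mono fun a (ha : 0 < a) => ha.ne')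
    (fun K hK => by
      refine (hopt.1.sub (integrable_const (Real.log K))).congr (ae_of_all _ fun θ => ?_)
      exact (Real.log_div (hL θ).ne' hK.ne').symm) hD
  have hI := hopt.1
  simp only [limitInfo_eq hJ hα] at hI
  unfold utilZero at key hI
  have hW := integrable_logisticWeight (∑ s, α s) θ₀ μ
  set A := ∑ s, α s
  have hq : 0 ≤ -(1 - 6 * ∫ θ, logisticWeight (A * (θ - θ₀)) ∂μ) := by
    refine nonneg_of_forall_pos_quadratic (b := 1) fun ε hε => ?_
    obtain ⟨hi, hle⟩ := key (1 + ε) (by linarith)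
    have hpt : ∀ θ, Real.log (A ^ 2 * logisticWeight (A * (θ - θ₀)))
        + (ε * (1 - 6 * logisticWeight (A * (θ - θ₀))) - ε ^ 2)
        ≤ Real.log (A ^ 2 * pairWeight (Real.cosh (A * (θ - θ₀))) (1 + ε)) := by
      intro θ
      have h := log_pairWeight_ge (A * (θ - θ₀)) (D := 1 + ε) (by linarith)
      have hp : 0 < pairWeight (Real.cosh (A * (θ - θ₀))) (1 + ε) := by
        have := Real.cosh_pos (A * (θ - θ₀))
        unfold pairWeight
        positivity
      rw [Real.log_mul (pow_pos hA 2).ne' (logisticWeight_pos _).ne',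
        Real.log_mul (pow_pos hA 2).ne' hp.ne']
      rw [add_sub_cancel_left] at h
      linarith
    have h1 : Integrable (fun θ => 1 - 6 * logisticWeight (A * (θ - θ₀))) μ :=
      (integrable_const 1).sub (hW.const_mul 6)
    have h2 : Integrable (fun θ => ε * (1 - 6 * logisticWeight (A * (θ - θ₀))) - ε ^ 2) μ :=
      (h1.const_mul ε).sub (integrable_const _)
    have h := integral_mono (hI.add h2) hi hpt
    simp only [Pi.add_apply] at h
    rw [integral_add hI h2, integral_sub (h1.const_mul ε) (integrable_const _),
      integral_const_mul, integral_sub (integrable_const 1) (hW.const_mul 6),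
      integral_const_mul] at h
    simp only [integral_const, probReal_univ, smul_eq_mul, one_mul] at h
    linarith
  linarith

theorem LimitBayesOptimal.integral_inv_le_six (hJ : 1 ≤ J) (hα : ∀ s, 0 < α s)
    {μ : Measure ℝ} [IsProbabilityMeasure μ] {θ₀ : ℝ}
    (hopt : LimitBayesOptimal utilNegOne μ α θ₀) :
    Integrable (fun θ => (logisticWeight ((∑ s, α s) * (θ - θ₀)))⁻¹) μ ∧
      ∫ θ, (logisticWeight ((∑ s, α s) * (θ - θ₀)))⁻¹ ∂μ ≤ 6 := by
  have hA := sum_disc_pos hJ hα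
  have key := fun (D : ℝ) (hD : 1 ≤ D) => hopt.integral_pairWeight_le hJ hα
    (fun a (ha : 0 < a) b _ hab => neg_le_neg (inv_anti₀ ha hab))
    (continuousOn_inv₀.neg.mono fun a (ha : 0 < a) => ha.ne')
    (fun K _ => by
      refine (hopt.1.const_mul K).congr (ae_of_all _ fun θ => ?_)
      simp only [utilNegOne, inv_div]
      ring) hD
  have hI := hopt.1
  simp only [limitInfo_eq hJ hα] at hI
  unfold utilNegOne at key hI
  set A := ∑ s, α s
  have hW : Integrable (fun θ => (logisticWeight (A * (θ - θ₀)))⁻¹) μ := by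
    refine (hI.const_mul (-A ^ 2)).congr (ae_of_all _ fun θ => ?_)
    have := (logisticWeight_pos (A * (θ - θ₀))).ne'
    field_simp
  refine ⟨hW, ?_⟩
  have hC : Integrable (fun θ => Real.cosh (A * (θ - θ₀))) μ := by
    refine ((hW.div_const 2).sub (integrable_const 1)).congr (ae_of_all _ fun θ => ?_)
    simp only [Pi.sub_apply, inv_logisticWeight]
    ring
  have hq : 0 ≤ 2 * (2 - ∫ θ, Real.cosh (A * (θ - θ₀)) ∂μ) := by
    refine nonneg_of_forall_pos_quadratic (b := 2 * ∫ θ, Real.cosh (A * (θ - θ₀)) ∂μ)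
      fun ε hε => ?_
    obtain ⟨hi, hle⟩ := key (1 + ε) (by linarith)
    rw [integral_neg, integral_neg, neg_le_neg_iff] at hle
    simp only [mul_inv, integral_const_mul] at hle
    have hle' := le_of_mul_le_mul_left hle (inv_pos.2 (pow_pos hA 2))
    have hi' : Integrable (fun θ => (pairWeight (Real.cosh (A * (θ - θ₀))) (1 + ε))⁻¹) μ := by
      refine (hi.const_mul (-A ^ 2)).congr (ae_of_all _ fun θ => ?_)
      simp only [mul_inv]
      field_simp
    have h1 : Integrable (fun θ => 2 * ε * (2 - Real.cosh (A * (θ - θ₀)))) μ :=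
      ((integrable_const 2).sub hC).const_mul _
    have h2 : Integrable (fun θ => 2 * ε ^ 2 * Real.cosh (A * (θ - θ₀))) μ := hC.const_mul _
    have hW1 : Integrable (fun θ => (logisticWeight (A * (θ - θ₀)))⁻¹
        + 2 * ε * (2 - Real.cosh (A * (θ - θ₀)))) μ := hW.add h1
    have h := integral_mono hi' (hW1.add h2) fun θ => by
      have := inv_pairWeight_le (Real.one_le_cosh (A * (θ - θ₀))) (D := 1 + ε) (by linarith)
      rw [add_sub_cancel_left] at this
      simpa only [Pi.add_apply, inv_logisticWeight] using this
    simp only [Pi.add_apply] at h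
    rw [integral_add hW1 h2, integral_add hW h1, integral_const_mul, integral_const_mul,
      integral_sub (integrable_const 2) hC] at h
    simp only [integral_const, probReal_univ, smul_eq_mul, one_mul] at h
    linarith
  have e : ∫ θ, (logisticWeight (A * (θ - θ₀)))⁻¹ ∂μ
      = 2 * (1 + ∫ θ, Real.cosh (A * (θ - θ₀)) ∂μ) := by
    simp only [inv_logisticWeight]
    rw [integral_const_mul, integral_add (integrable_const 1) hC]
    simp
  linarith

end

end GPCM

end

theorem theorem2 {J : ℕ} (hJ : 1 ≤ J) (α : Fin J → ℝ) (hα : ∀ s, 0 < α s)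
    (μ : MeasureTheory.Measure ℝ) [MeasureTheory.IsProbabilityMeasure μ] (θ₀ : ℝ)
    (hsymm : GPCM.SymmetricAround μ θ₀) :
    (GPCM.LimitBayesOptimal GPCM.utilZero μ α θ₀ →
      MeasureTheory.Integrable (fun θ => GPCM.limitCatProb α θ₀ θ (Fin.last J) *
          GPCM.limitCatProb α θ₀ θ 0) μ ∧
        1 / 6 ≤ ∫ θ, GPCM.limitCatProb α θ₀ θ (Fin.last J) * GPCM.limitCatProb α θ₀ θ 0 ∂μ) ∧
    (GPCM.LimitBayesOptimal GPCM.utilNegOne μ α θ₀ →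
      MeasureTheory.Integrable (fun θ => (GPCM.limitCatProb α θ₀ θ (Fin.last J) *
          GPCM.limitCatProb α θ₀ θ 0)⁻¹) μ ∧
        ∫ θ, (GPCM.limitCatProb α θ₀ θ (Fin.last J) * GPCM.limitCatProb α θ₀ θ 0)⁻¹ ∂μ ≤ 6) := by
  simp only [GPCM.limitCatProb_mul_eq hJ hα]
  exact ⟨fun hopt => ⟨GPCM.integrable_logisticWeight _ θ₀ μ, hopt.one_sixth_le_integral hJ hα⟩,
    fun hopt => hopt.integral_inv_le_six hJ hα⟩
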